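/- Let $I=[0,1]$ and let $f:I\to I$ be continuous. Let $\mathcal K(I)$ be the space of all non-empty compact subsets of $I$ with the Hausdorff metric $d_H$, and let $\overline f:\mathcal K(I)\to\mathcal K(I)$, $\overline f(K)=f(K)$, be the induced map. A continuous self-map $g$ of a compact metric space $(X,d)$ is called generically chaotic if the set of its Li–Yorke pairs $$C(g)=\Bigl\{(x,y)\in X^2:\ \liminf_{n\to\infty} d(g^n(x),g^n(y))=0\ \text{ and }\ \limsup_{n\to\infty} d(g^n(x),g^n(y))>0\Bigr\}$$ is residual in $X^2$, i.e. its complement in $X^2$ is a countable union of nowhere dense sets. If $\overline f$ is generically chaotic (on $(\mathcal K(I),d_H)$), then $f$ is generically chaotic (on $I$ with the usual metric). -/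

import Mathlib

open Filter TopologicalSpace

namespace HyperChaos

noncomputable section

/-- The pairs `(x, y)` whose orbits satisfy `liminf d(fⁿ x, fⁿ y) = 0`. The space is compact, so
the sequence of distances is bounded and the real `liminf` is the genuine one. -/
def C₁ {X : Type*} [MetricSpace X] [CompactSpace X] (f : C(X, X)) : Set (X × X) :=
  {p | liminf (fun n : ℕ => dist (f^[n] p.1) (f^[n] p.2)) atTop = 0}

/-- The pairs `(x, y)` whose orbits satisfy `limsup d(fⁿ x, fⁿ y) > 0`. -/
def C₂ {X : Type*} [MetricSpace X] [CompactSpace X] (f : C(X, X)) : Set (X × X) :=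
  {p | 0 < limsup (fun n : ℕ => dist (f^[n] p.1) (f^[n] p.2)) atTop}

/-- The set of Li–Yorke pairs of `f`. -/
def liYorkePairs {X : Type*} [MetricSpace X] [CompactSpace X] (f : C(X, X)) : Set (X × X) :=
  C₁ f ∩ C₂ f

/-- `f` is generically chaotic if its Li–Yorke pairs form a residual subset of `X × X`
(a set whose complement is of first category). -/
def GenericallyChaotic {X : Type*} [MetricSpace X] [CompactSpace X] (f : C(X, X)) : Prop :=
  liYorkePairs f ∈ residual (X × X)

/-- The map `K ↦ f(K)` induced by `f` on the hyperspace of nonempty compact subsets of `X`. The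
hyperspace carries Mathlib's Hausdorff metric, whose topology is the Vietoris topology. -/
def inducedMap {X : Type*} [MetricSpace X] [CompactSpace X] (f : C(X, X)) :
    C(NonemptyCompacts X, NonemptyCompacts X) where
  toFun K := K.map f f.continuous
  continuous_toFun := f.continuous.nonemptyCompacts_map

end

end HyperChaos

open Set Topology

namespace HyperChaos

section Hyperspace

variable {X : Type*} [MetricSpace X]

/-! Compact pairs with `K ×ˢ L ⊆ A` form an open set if `A` is open, and a dense one if `A` is also
dense. Hence generic properties of compact pairs can be tested inside any open `W`. For `C₁`: a pair
in `C₁ (inducedMap f)` with product in `W` has points coming close at late times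
(`C₁_mem_residual`). For `C₂`: were locally `ε`-close pairs dense in `W` for every `ε = 1 / (k +
1)`, some pair in `C₂ (inducedMap f)` would have its product made of such pairs for all `k`; by
compactness its images would merge, a contradiction (`C₂_mem_residual`). -/

theorem isOpen_setOf_prod_subset {A : Set (X × X)} (hA : IsOpen A) :
    IsOpen {P : NonemptyCompacts X × NonemptyCompacts X | (P.1 : Set X) ×ˢ (P.2 : Set X) ⊆ A} :=
  (NonemptyCompacts.isOpen_subsets_of_isOpen hA).preimage NonemptyCompacts.continuous_prod

variable [CompactSpace X] in
/-- Pairs of compact sets whose product lies in a given dense open set are dense: a pair of finite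
sets can be moved into general position. -/
theorem dense_setOf_prod_subset {A : Set (X × X)} (hA : IsOpen A) (hd : Dense A) :
    Dense {P : NonemptyCompacts X × NonemptyCompacts X |
      (P.1 : Set X) ×ˢ (P.2 : Set X) ⊆ A} := by
  rw [← dense_closure]
  refine ((NonemptyCompacts.dense_setOfPred_finite (α := X)).prod
    (NonemptyCompacts.dense_setOfPred_finite (α := X))).mono ?_
  rintro ⟨K, L⟩ ⟨hK, hL⟩
  rw [Metric.mem_closure_iff]
  intro ε hε
  have : Fintype K := Set.Finite.fintype hK
  have : Fintype L := Set.Finite.fintype hL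
  have hKn : Nonempty K := K.nonempty.to_subtype
  have hLn : Nonempty L := L.nonempty.to_subtype
  -- Points of `K` and of `L` move independently, even common ones, so each of the finitely many
  -- conditions is open and dense.
  have hdense : Dense (⋂ q : K × L, {z : (K → X) × (L → X) | (z.1 q.1, z.2 q.2) ∈ A}) := by
    refine dense_iInter_of_isOpen (fun q => hA.preimage (by fun_prop)) fun q => ?_
    exact hd.preimage ((isOpenMap_eval q.1).prodMap (isOpenMap_eval q.2))
  obtain ⟨z, hz, hdist⟩ := Metric.dense_iff.1 hdense
    ((fun i => (i : X)), (fun j => (j : X))) (ε / 2) (half_pos hε)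
  rw [Metric.mem_ball, Prod.dist_eq, max_lt_iff] at hz
  have key : ∀ (M : NonemptyCompacts X) [Fintype M] (w : M → X) (hw : (range w).Nonempty),
      dist w (fun i => (i : X)) < ε / 2 →
      dist M ⟨⟨range w, (finite_range w).isCompact⟩, hw⟩ < ε := by
    intro M _ w hw h
    refine lt_of_le_of_lt ?_ (half_lt_self hε)
    rw [Metric.NonemptyCompacts.dist_eq]
    refine Metric.hausdorffDist_le_of_mem_dist (half_pos hε).le (fun x hx => ?_) ?_
    · refine ⟨w ⟨x, hx⟩, mem_range_self _, ?_⟩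
      rw [dist_comm]
      exact (dist_le_pi_dist w (fun i => (i : X)) ⟨x, hx⟩).trans h.le
    · rintro _ ⟨i, rfl⟩
      exact ⟨i, i.2, (dist_le_pi_dist w (fun i => (i : X)) i).trans h.le⟩
  refine ⟨(⟨⟨range z.1, (finite_range _).isCompact⟩, range_nonempty _⟩,
    ⟨⟨range z.2, (finite_range _).isCompact⟩, range_nonempty _⟩), ?_, ?_⟩
  · rintro ⟨_, _⟩ ⟨⟨i, rfl⟩, ⟨j, rfl⟩⟩
    exact mem_iInter.1 hdist (i, j)
  · rw [Prod.dist_eq, max_lt_iff]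
    exact ⟨key K z.1 (range_nonempty _) hz.1, key L z.2 (range_nonempty _) hz.2⟩

end Hyperspace

section Pairs

variable {X : Type*} [MetricSpace X] (f : C(X, X))

theorem continuous_dist_iterate (n : ℕ) :
    Continuous fun p : X × X => dist (f^[n] p.1) (f^[n] p.2) :=
  ((f.continuous.iterate n).comp continuous_fst).dist
    ((f.continuous.iterate n).comp continuous_snd)

theorem isBoundedUnder_ge_dist_iterate (p : X × X) :
    IsBoundedUnder (· ≥ ·) atTop fun n : ℕ => dist (f^[n] p.1) (f^[n] p.2) :=
  isBoundedUnder_of ⟨0, fun _ => dist_nonneg⟩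

/-- The pairs around which the orbits stay uniformly `ε`-close from some time on. -/
def locallyClosePairs (ε : ℝ) : Set (X × X) :=
  ⋃ N : ℕ, interior {p | ∀ n ≥ N, dist (f^[n] p.1) (f^[n] p.2) ≤ ε}

variable {f} in
theorem isOpen_locallyClosePairs (ε : ℝ) : IsOpen (locallyClosePairs f ε) :=
  isOpen_iUnion fun _ => isOpen_interior

variable [CompactSpace X]

theorem isBoundedUnder_dist_iterate (p : X × X) :
    IsBoundedUnder (· ≤ ·) atTop fun n : ℕ => dist (f^[n] p.1) (f^[n] p.2) :=
  isBoundedUnder_of ⟨Metric.diam (univ : Set X), fun _ =>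
    Metric.dist_le_diam_of_mem isCompact_univ.isBounded (mem_univ _) (mem_univ _)⟩

variable {f}

theorem mem_C₁_iff {p : X × X} :
    p ∈ C₁ f ↔ ∀ ε > 0, ∃ᶠ n in atTop, dist (f^[n] p.1) (f^[n] p.2) < ε := by
  have hb := isBoundedUnder_dist_iterate f p
  have hb' := isBoundedUnder_ge_dist_iterate f p
  constructor
  · intro h ε hε
    exact frequently_lt_of_liminf_lt hb.isCoboundedUnder_ge (lt_of_eq_of_lt h hε)
  · intro h
    refine le_antisymm (le_of_forall_pos_le_add fun ε hε => ?_) ?_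
    · rw [zero_add]
      exact liminf_le_of_frequently_le ((h ε hε).mono fun _ hn => hn.le) hb'
    · exact le_liminf_of_le hb.isCoboundedUnder_ge (.of_forall fun _ => dist_nonneg)

theorem mem_C₂_iff {p : X × X} :
    p ∈ C₂ f ↔ ∃ ε > 0, ∃ᶠ n in atTop, ε < dist (f^[n] p.1) (f^[n] p.2) := by
  have hb := isBoundedUnder_dist_iterate f p
  have hb' := isBoundedUnder_ge_dist_iterate f p
  constructor
  · intro h
    obtain ⟨ε, hε, hlt⟩ := exists_between (show (0 : ℝ) < _ from h)
    exact ⟨ε, hε, frequently_lt_of_lt_limsup hb'.isCoboundedUnder_le hlt⟩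
  · rintro ⟨ε, hε, h⟩
    exact hε.trans_le (le_limsup_of_frequently_le (h.mono fun _ hn => hn.le) hb)

theorem coe_inducedMap_iterate (n : ℕ) (K : NonemptyCompacts X) :
    (((inducedMap f)^[n] K : NonemptyCompacts X) : Set X) = f^[n] '' K := by
  induction n with
  | zero => simp
  | succ n ih =>
    rw [Function.iterate_succ_apply', Function.iterate_succ', image_comp, ← ih]
    rfl

/-- Compact sets whose product consists of locally `ε`-close pairs have eventually `ε`-close images
in the hyperspace. -/
theorem eventually_dist_inducedMap_le {ε : ℝ} (hε : 0 ≤ ε)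
    {P : NonemptyCompacts X × NonemptyCompacts X}
    (hP : (P.1 : Set X) ×ˢ (P.2 : Set X) ⊆ locallyClosePairs f ε) :
    ∀ᶠ n in atTop, dist ((inducedMap f)^[n] P.1) ((inducedMap f)^[n] P.2) ≤ ε := by
  have hmono : Monotone fun N : ℕ =>
      interior {p : X × X | ∀ n ≥ N, dist (f^[n] p.1) (f^[n] p.2) ≤ ε} := fun M N hMN =>
    interior_mono fun p hp n hn => hp n (hMN.trans hn)
  obtain ⟨N, hN⟩ := (P.1.isCompact.prod P.2.isCompact).elim_directed_cover _
    (fun _ => isOpen_interior) hP hmono.directed_le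
  filter_upwards [eventually_ge_atTop N] with n hn
  have hclose : ∀ x ∈ P.1, ∀ y ∈ P.2, dist (f^[n] x) (f^[n] y) ≤ ε := fun x hx y hy =>
    interior_subset (hN (mk_mem_prod hx hy)) n hn
  obtain ⟨x₀, hx₀⟩ := P.1.nonempty
  obtain ⟨y₀, hy₀⟩ := P.2.nonempty
  rw [Metric.NonemptyCompacts.dist_eq, coe_inducedMap_iterate, coe_inducedMap_iterate]
  refine Metric.hausdorffDist_le_of_mem_dist hε ?_ ?_
  · rintro _ ⟨x, hx, rfl⟩
    exact ⟨_, mem_image_of_mem _ hy₀, hclose x hx y₀ hy₀⟩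
  · rintro _ ⟨y, hy, rfl⟩
    refine ⟨_, mem_image_of_mem _ hx₀, ?_⟩
    rw [dist_comm]
    exact hclose x₀ hx₀ y hy

/-- Density suffices: the sets `G q` are open, so only their density needs proof. -/
theorem C₁_mem_residual (h : Dense (C₁ (inducedMap f))) : C₁ f ∈ residual (X × X) := by
  let G : ℕ × ℕ → Set (X × X) := fun q =>
    ⋃ n ≥ q.2, {p | dist (f^[n] p.1) (f^[n] p.2) < 1 / ((q.1 : ℝ) + 1)}
  have hG : ∀ q, G q ∈ residual (X × X) := by
    rintro ⟨k, N⟩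
    refine residual_of_dense_open (isOpen_biUnion fun n _ =>
      isOpen_lt (continuous_dist_iterate f n) continuous_const) ?_
    rw [dense_iff_inter_open]
    rintro W hW ⟨⟨a, b⟩, hab⟩
    obtain ⟨⟨K, L⟩, hKL, hC⟩ := h.inter_open_nonempty _ (isOpen_setOf_prod_subset hW)
      ⟨({a}, {b}), by simpa using hab⟩
    obtain ⟨n, hlt, hn⟩ := ((mem_C₁_iff.1 hC _ (Nat.one_div_pos_of_nat (n := k))).and_eventually
      (eventually_ge_atTop N)).exists
    obtain ⟨x, hx⟩ := K.nonempty
    rw [Metric.NonemptyCompacts.dist_eq, coe_inducedMap_iterate, coe_inducedMap_iterate] at hlt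
    obtain ⟨_, ⟨y, hy, rfl⟩, hxy⟩ := Metric.exists_dist_lt_of_hausdorffDist_lt
      (mem_image_of_mem _ hx) hlt (Metric.hausdorffEDist_ne_top_of_nonempty_of_bounded
        (K.nonempty.image _) (L.nonempty.image _)
        (K.isCompact.image (f.continuous.iterate n)).isBounded
        (L.isCompact.image (f.continuous.iterate n)).isBounded)
    exact ⟨(x, y), hKL (mk_mem_prod hx hy), mem_biUnion hn hxy⟩
  refine mem_of_superset (countable_iInter_mem.2 hG) fun p hp => mem_C₁_iff.2 fun ε hε => ?_
  obtain ⟨k, hk⟩ := exists_nat_one_div_lt hε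
  refine frequently_atTop.2 fun N => ?_
  obtain ⟨n, hn, hlt⟩ := mem_iUnion₂.1 (mem_iInter.1 hp (k, N))
  exact ⟨n, hn, lt_trans hlt hk⟩

/-- If the pairs of compact sets with positive `limsup` are residual, then the locally `ε`-close
pairs, for `ε` running through a sequence of positive numbers, cannot all be dense in the same
nonempty open set. -/
theorem exists_not_subset_closure_locallyClosePairs
    (h : C₂ (inducedMap f) ∈ residual (NonemptyCompacts X × NonemptyCompacts X))
    {W : Set (X × X)} (hW : IsOpen W) (hne : W.Nonempty) :
    ∃ k : ℕ, ¬ W ⊆ closure (locallyClosePairs f (1 / ((k : ℝ) + 1))) := by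
  by_contra! hcl
  -- Adding the exterior of `W` turns density in `W` into density everywhere, and adds nothing to
  -- products inside `W`.
  have hE : ∀ k : ℕ, {P : NonemptyCompacts X × NonemptyCompacts X | (P.1 : Set X) ×ˢ (P.2 : Set X) ⊆
      locallyClosePairs f (1 / ((k : ℝ) + 1)) ∪ (closure W)ᶜ} ∈ residual _ := by
    intro k
    have ho : IsOpen (locallyClosePairs f (1 / ((k : ℝ) + 1)) ∪ (closure W)ᶜ) :=
      (isOpen_locallyClosePairs _).union isClosed_closure.isOpen_compl
    refine residual_of_dense_open (isOpen_setOf_prod_subset ho) (dense_setOf_prod_subset ho ?_)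
    intro p
    by_cases hp : p ∈ closure W
    · exact closure_mono subset_union_left (closure_minimal (hcl k) isClosed_closure hp)
    · exact subset_closure (Or.inr hp)
  obtain ⟨⟨a, b⟩, hab⟩ := hne
  obtain ⟨P, hPW, hP, hPE⟩ := (dense_of_mem_residual
    (inter_mem h (countable_iInter_mem.2 hE))).inter_open_nonempty _
      (isOpen_setOf_prod_subset hW) ⟨({a}, {b}), by simpa using hab⟩
  obtain ⟨ε, hε, hfreq⟩ := mem_C₂_iff.1 hP
  obtain ⟨k, hk⟩ := exists_nat_one_div_lt hε
  have hsub : (P.1 : Set X) ×ˢ (P.2 : Set X) ⊆ locallyClosePairs f (1 / ((k : ℝ) + 1)) :=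
    fun p hp => (mem_iInter.1 hPE k hp).resolve_right fun hn => hn (subset_closure (hPW hp))
  obtain ⟨n, hlt, hle⟩ := (hfreq.and_eventually
    (eventually_dist_inducedMap_le Nat.one_div_pos_of_nat.le hsub)).exists
  linarith

theorem C₂_mem_residual
    (h : C₂ (inducedMap f) ∈ residual (NonemptyCompacts X × NonemptyCompacts X)) :
    C₂ f ∈ residual (X × X) := by
  let B : ℕ × ℕ → Set (X × X) := fun q =>
    {p | ∀ n ≥ q.2, dist (f^[n] p.1) (f^[n] p.2) ≤ 1 / ((q.1 : ℝ) + 1)}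
  have hB : ∀ q, IsClosed (B q) := fun q => by
    simp only [B, ofPred_forall]
    exact isClosed_biInter fun n _ => isClosed_le (continuous_dist_iterate f n) continuous_const
  -- Frontiers of closed sets are nowhere dense; off them, avoiding the interior of `B q` means
  -- avoiding `B q`.
  have hfr : ∀ q, (frontier (B q))ᶜ ∈ residual (X × X) := fun q =>
    residual_of_dense_open isClosed_frontier.isOpen_compl
      (interior_eq_empty_iff_dense_compl.1 (interior_frontier (hB q)))
  have hΩ : ⋃ k : ℕ, (closure (locallyClosePairs f (1 / ((k : ℝ) + 1))))ᶜ ∈ residual (X × X) := by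
    refine residual_of_dense_open (isOpen_iUnion fun _ => isClosed_closure.isOpen_compl) ?_
    rw [dense_iff_inter_open]
    intro W hW hne
    obtain ⟨k, hk⟩ := exists_not_subset_closure_locallyClosePairs h hW hne
    obtain ⟨p, hpW, hp⟩ := not_subset.1 hk
    exact ⟨p, hpW, mem_iUnion.2 ⟨k, hp⟩⟩
  refine mem_of_superset (inter_mem hΩ (countable_iInter_mem.2 hfr)) ?_
  rintro p ⟨hpΩ, hpfr⟩
  obtain ⟨k, hk⟩ := mem_iUnion.1 hpΩ
  refine mem_C₂_iff.2 ⟨1 / ((k : ℝ) + 1), Nat.one_div_pos_of_nat, frequently_atTop.2 fun N => ?_⟩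
  have hpB : p ∉ B (k, N) := fun hp => by
    have hint : p ∉ interior (B (k, N)) := fun hi => hk (subset_closure (mem_iUnion.2 ⟨N, hi⟩))
    exact mem_iInter.1 hpfr (k, N) ⟨subset_closure hp, hint⟩
  simpa [B] using hpB

/-- Generic chaos of the induced map on the hyperspace implies generic chaos of the map. -/
theorem GenericallyChaotic.of_inducedMap (h : GenericallyChaotic (inducedMap f)) :
    GenericallyChaotic f :=
  inter_mem
    (C₁_mem_residual (dense_of_mem_residual (mem_of_superset h inter_subset_left)))
    (C₂_mem_residual (mem_of_superset h inter_subset_right))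

end Pairs

end HyperChaos

theorem theorem2p1 (f : C(unitInterval, unitInterval))
    (hf : HyperChaos.GenericallyChaotic (HyperChaos.inducedMap f)) :
    HyperChaos.GenericallyChaotic f := by
  exact hf.of_inducedMap
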